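/- Let $\lambda=(\lambda_1\ge\lambda_2\ge\cdots)$ be a non-empty partition, i.e. a weakly decreasing sequence of non-negative integers with only finitely many, but at least one, non-zero terms; let $l(\lambda)$ be the number of its non-zero terms and $|\lambda|=\sum_i\lambda_i$. For integers $k\ge\max(l(\lambda),\lambda_1)$ put $$D_\lambda(k)=\det\left(\binom{2k-i-\lambda_{k-i+1}}{2k-2j}\right)_{1\le i,j\le k}.$$ There is exactly one polynomial $P_\lambda\in\mathbb{Q}[k]$ such that $D_\lambda(k)=2^{\binom k2-|\lambda|}\,P_\lambda(k)$ for all integers $k\ge\max(l(\lambda),\lambda_1)$, and it has the following divisibility properties in $\mathbb{Q}[k]$. If $\lambda_1<l(\lambda)$, then $P_\lambda(k)$ is divisible by $\prod_{a=\lambda_1}^{l(\lambda)-1}(k-a)=(k-\lambda_1)(k-\lambda_1-1)\cdots(k-l(\lambda)+1)$. If $\lambda_1\ge l(\lambda)$, then $P_\lambda(k)$ is divisible by $\prod_{a=l(\lambda)}^{\lambda_1}(k+a)=(k+\lambda_1)(k+\lambda_1-1)\cdots(k+l(\lambda))$. -/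

import Mathlib

open Polynomial

/-- A partition `λ₁ ≥ λ₂ ≥ ⋯`: a finitely supported, weakly decreasing sequence of natural
numbers. Sequences are indexed from `0`, so that `lam i` is the part `λ_{i+1}`; in particular
`lam 0` is the largest part `λ₁`. -/
def IsPartitionSeq (lam : ℕ →₀ ℕ) : Prop :=
  Antitone (fun i => lam i)

/-- The length `l(λ)`: the number of non-zero parts. -/
def partLength (lam : ℕ →₀ ℕ) : ℕ :=
  lam.support.card

/-- The weight `|λ| = ∑ λ_i`. -/
def partWeight (lam : ℕ →₀ ℕ) : ℕ :=
  ∑ i ∈ lam.support, lam i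

/-- The `k × k` matrix with entries `binom (2k - i - λ_{k-i+1}) (2k - 2j)` for `1 ≤ i, j ≤ k`.
The row `i : Fin k` is the row number `i + 1`, and likewise for columns; the upper argument of
the binomial coefficient is an integer, and the two natural-number subtractions do not truncate. -/
noncomputable def binomMatrix (lam : ℕ →₀ ℕ) (k : ℕ) : Matrix (Fin k) (Fin k) ℤ :=
  Matrix.of fun i j =>
    Ring.choose (2 * (k : ℤ) - ((i : ℕ) + 1 : ℤ) - (lam (k - (i + 1)) : ℤ))
      (2 * k - 2 * ((j : ℕ) + 1))

/-- The determinant `D_λ(k)`. -/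
noncomputable def binomDet (lam : ℕ →₀ ℕ) (k : ℕ) : ℤ :=
  (binomMatrix lam k).det

/-- The property that defines the polynomial `P_λ`: one has
`D_λ(k) = 2 ^ (binom k 2 - |λ|) * P_λ(k)` for all `k ≥ max (l(λ), λ₁)`. The exponent is an
integer that may be negative. -/
def IsDetPolynomial (lam : ℕ →₀ ℕ) (P : ℚ[X]) : Prop :=
  ∀ k : ℕ, max (partLength lam) (lam 0) ≤ k →
    (binomDet lam k : ℚ) =
      (2 : ℚ) ^ ((k.choose 2 : ℤ) - (partWeight lam : ℤ)) * P.eval (k : ℚ)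

/-! Reverse rows and columns: row `i` (from 0) becomes `binom x (2j)` with `x = k + i - λ`, `λ = lam
i`. Its generating function in `y = 1 - 2z` is `2^(x-1) ((1-z)^x + z^x)`. Since `y^2 = 1 - 4z(1-z)`,
passing to coefficients of `z^n`, `n < k`, after multiplying by `(1-z)^(-k)`, costs only a sign and
a power of 2 (`choose_even_matrix_mul`).

Now re-expand modulo `z^k` in powers of `1 - z`. If `λ ≤ i`, the row is the unit vector at `i - λ`,
so the determinant shrinks to size `l(λ)` (`det_eq_det_of_unit_rows`). Otherwise its entries are
polynomials in `k` (`sum_coeff_eq_entryPoly_eval`). The small determinant is `P_λ`; at each claimed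
root one of its columns or rows vanishes. -/

/-! ### Generating functions of the rows and the change of basis. -/

open Finset in
theorem sum_range_two_mul {M : Type*} [AddCommMonoid M] (f : ℕ → M) (k : ℕ) :
    ∑ n ∈ range (2 * k), f n = ∑ j ∈ range k, (f (2 * j) + f (2 * j + 1)) := by
  induction k with
  | zero => simp
  | succ k ih => rw [mul_add, mul_one, sum_range_succ, sum_range_succ, sum_range_succ, ih, add_assoc]

open Finset in
theorem one_add_pow_eq_sum_range {R : Type*} [CommRing R] (y : R) {x N : ℕ} (h : x < N) :
    (1 + y) ^ x = ∑ n ∈ range N, (x.choose n : R) * y ^ n := by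
  rw [add_comm, add_pow]
  have hs : range (x + 1) ⊆ range N := range_subset_range.2 h
  rw [← sum_subset hs]
  · exact sum_congr rfl fun n _ => by simp [mul_comm]
  · intro n _ hn
    rw [Nat.choose_eq_zero_of_lt (by simpa using hn)]
    simp

open Finset in
theorem two_mul_sum_choose_even {R : Type*} [CommRing R] (y : R) {x k : ℕ} (h : x < 2 * k) :
    2 * ∑ j ∈ range k, (x.choose (2 * j) : R) * y ^ (2 * j) = (1 + y) ^ x + (1 - y) ^ x := by
  rw [sub_eq_add_neg, one_add_pow_eq_sum_range y h, one_add_pow_eq_sum_range (-y) h,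
    sum_range_two_mul, sum_range_two_mul, ← sum_add_distrib, mul_sum]
  refine sum_congr rfl fun j _ => ?_
  rw [Even.neg_pow (by simp), Odd.neg_pow (by simp)]
  ring

/-- The matrix of the substitution `z ↦ 1 - z` in the monomial basis. -/
def reflMatrix (k : ℕ) : Matrix (Fin k) (Fin k) ℚ :=
  Matrix.of fun n j => (-1) ^ (j : ℕ) * ((n : ℕ).choose j : ℚ)

-- Compare coefficients of `X ^ j` in `X ^ i = (1 - (1 - X)) ^ i`.
open Finset in
theorem sum_choose_mul_choose_alternating {k i : ℕ} (hi : i < k) (j : ℕ) :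
    ∑ n ∈ range k, ((-1) ^ n * (i.choose n : ℚ)) * ((-1) ^ j * (n.choose j : ℚ)) =
      if j = i then 1 else 0 := by
  have key : (X : ℚ[X]) ^ i = ∑ n ∈ range k, ((-1) ^ n * (i.choose n : ℚ[X])) * (1 - X) ^ n := by
    have := one_add_pow_eq_sum_range (-(1 - X) : ℚ[X]) hi
    rw [show (1 : ℚ[X]) + -(1 - X) = X by ring] at this
    rw [this]
    refine sum_congr rfl fun n _ => ?_
    rw [neg_pow (1 - X : ℚ[X])]
    ring
  have := congrArg (fun p => coeff p j) key
  simp only [coeff_X_pow, finsetSum_coeff] at this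
  rw [this]
  refine sum_congr rfl fun n _ => ?_
  have hc : ((-1) ^ n * (i.choose n : ℚ[X])) = C ((-1) ^ n * (i.choose n : ℚ)) := by simp
  rw [hc, coeff_C_mul]
  congr 1
  rw [show (1 - X : ℚ[X]) = (1 + X).comp (C (-1) * X) by simp [sub_eq_add_neg],
    ← pow_comp, comp_C_mul_X_coeff, coeff_one_add_X_pow, mul_comm]

theorem reflMatrix_mul_self (k : ℕ) : reflMatrix k * reflMatrix k = 1 := by
  ext i j
  rw [Matrix.mul_apply, Matrix.one_apply]
  simp only [reflMatrix, Matrix.of_apply]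
  rw [Fin.sum_univ_eq_sum_range
    (fun n => ((-1) ^ n * ((i : ℕ).choose n : ℚ)) * ((-1) ^ (j : ℕ) * (n.choose j : ℚ))) k,
    sum_choose_mul_choose_alternating i.2]
  simp [Fin.ext_iff, eq_comm]

theorem reflMatrix_det_mul_self (k : ℕ) : (reflMatrix k).det * (reflMatrix k).det = 1 := by
  rw [← Matrix.det_mul, reflMatrix_mul_self, Matrix.det_one]

/-- The power series `(1 - z) ^ (-k)` for `k = d + 1`. -/
noncomputable def invPow (d : ℕ) : PowerSeries ℚ :=
  PowerSeries.mk fun n => ((d + n).choose d : ℚ)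

theorem invPow_mul (d : ℕ) : invPow d * (1 - PowerSeries.X) ^ (d + 1) = 1 :=
  PowerSeries.mk_add_choose_mul_one_sub_pow_eq_one ℚ d

/-- The upper triangular matrix with the coefficients of `(4 z (1 - z)) ^ l (1 - z) ^ (-(d + 1))`. -/
noncomputable def substMatrix (d k : ℕ) : Matrix (Fin k) (Fin k) ℚ :=
  Matrix.of fun l n => PowerSeries.coeff (n : ℕ)
    ((PowerSeries.C 4 * PowerSeries.X * (1 - PowerSeries.X)) ^ (l : ℕ) * invPow d)

theorem det_substMatrix (d k : ℕ) : (substMatrix d k).det = 4 ^ (k.choose 2) := by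
  have hform (l n : ℕ) : PowerSeries.coeff n
      ((PowerSeries.C 4 * PowerSeries.X * (1 - PowerSeries.X)) ^ l * invPow d) =
      4 ^ l * PowerSeries.coeff n
        (PowerSeries.X ^ l * ((1 - PowerSeries.X) ^ l * invPow d)) := by
    rw [← PowerSeries.coeff_C_mul, map_pow, mul_pow, mul_pow]
    congr 1
    ring
  rw [Matrix.det_of_isUpperTriangular]
  · simp only [substMatrix, Matrix.of_apply, hform]
    have h1 (l : ℕ) : PowerSeries.coeff l
        (PowerSeries.X ^ l * ((1 - PowerSeries.X) ^ l * invPow d)) = 1 := by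
      rw [PowerSeries.coeff_X_pow_mul', if_pos le_rfl, Nat.sub_self,
        PowerSeries.coeff_zero_eq_constantCoeff_apply]
      have : PowerSeries.constantCoeff (invPow d) = 1 := by
        rw [← PowerSeries.coeff_zero_eq_constantCoeff_apply, invPow, PowerSeries.coeff_mk]
        simp
      simp [this]
    simp only [h1, mul_one]
    rw [Fin.prod_univ_eq_prod_range (fun l => (4 : ℚ) ^ l) k, Finset.prod_pow_eq_pow_sum,
      Finset.sum_range_id, Nat.choose_two_right]
  · intro l n hln
    simp only [substMatrix, Matrix.of_apply, hform]
    rw [PowerSeries.coeff_X_pow_mul', if_neg (by simpa using hln), mul_zero]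

/-- The matrix of the coefficients of `((1 - z) ^ x + z ^ x) (1 - z) ^ (-(d + 1))` for `x = x i`. -/
noncomputable def powerSumMatrix (d k : ℕ) (x : ℕ → ℕ) : Matrix (Fin k) (Fin k) ℚ :=
  Matrix.of fun i n => PowerSeries.coeff (n : ℕ)
    (((1 - PowerSeries.X) ^ x i + PowerSeries.X ^ x i) * invPow d)

theorem choose_even_matrix_mul (d k : ℕ) (x : ℕ → ℕ) (hx : ∀ i < k, x i < 2 * k) :
    (Matrix.of fun i j : Fin k => ((x i).choose (2 * j) : ℚ)) * (reflMatrix k * substMatrix d k) =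
      Matrix.of fun i n : Fin k => (2 ^ x i / 2) * powerSumMatrix d k x i n := by
  have hS (j n : Fin k) : (reflMatrix k * substMatrix d k) j n =
      PowerSeries.coeff (n : ℕ) ((1 - 2 * PowerSeries.X) ^ (2 * (j : ℕ)) * invPow d) := by
    rw [Matrix.mul_apply]
    simp only [reflMatrix, substMatrix, Matrix.of_apply, ← PowerSeries.coeff_C_mul]
    rw [← map_sum, Fin.sum_univ_eq_sum_range (fun l => PowerSeries.C ((-1) ^ l *
      ((j : ℕ).choose l : ℚ)) * ((PowerSeries.C 4 * PowerSeries.X * (1 - PowerSeries.X)) ^ l *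
      invPow d)) k]
    have := one_add_pow_eq_sum_range
      (-(PowerSeries.C 4 * PowerSeries.X * (1 - PowerSeries.X)) : PowerSeries ℚ) j.2
    rw [pow_mul, show (1 - 2 * PowerSeries.X : PowerSeries ℚ) ^ 2 =
      1 + -(PowerSeries.C 4 * PowerSeries.X * (1 - PowerSeries.X)) by
        rw [map_ofNat]; ring, this, Finset.sum_mul]
    congr 1
    refine Finset.sum_congr rfl fun l _ => ?_
    rw [neg_pow (PowerSeries.C 4 * PowerSeries.X * (1 - PowerSeries.X) : PowerSeries ℚ)]
    simp only [map_mul, map_pow, map_neg, map_one, map_natCast]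
    ring
  ext i n
  rw [Matrix.mul_apply]
  simp only [hS, powerSumMatrix, Matrix.of_apply, ← PowerSeries.coeff_C_mul]
  rw [← map_sum, Fin.sum_univ_eq_sum_range (fun j => PowerSeries.C ((x i).choose (2 * j) : ℚ) *
      ((1 - 2 * PowerSeries.X) ^ (2 * j) * invPow d)) k]
  congr 1
  have h2 := two_mul_sum_choose_even (1 - 2 * PowerSeries.X : PowerSeries ℚ) (hx i i.2)
  have hC : (PowerSeries.C (2 ^ x i / 2 : ℚ)) * 2 = 2 ^ x i := by
    rw [← map_ofNat (PowerSeries.C (R := ℚ)) 2, ← map_mul, ← map_pow]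
    congr 1
    ring
  have h4 : (2 : PowerSeries ℚ) ≠ 0 := by
    rw [← map_ofNat (PowerSeries.C (R := ℚ)) 2]
    intro h
    have := congrArg (PowerSeries.coeff 0) h
    simp at this
  apply mul_left_cancel₀ h4
  calc _ = (2 * ∑ j ∈ Finset.range k, ((x i).choose (2 * j) : PowerSeries ℚ) *
        (1 - 2 * PowerSeries.X) ^ (2 * j)) * invPow d := by
        rw [mul_assoc, Finset.sum_mul]
        congr 1
        exact Finset.sum_congr rfl fun j _ => by rw [map_natCast]; ring
    _ = (PowerSeries.C (2 ^ x i / 2 : ℚ) * 2) *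
        (((1 - PowerSeries.X) ^ x i + PowerSeries.X ^ x i) * invPow d) := by
        rw [h2, hC, show (1 + (1 - 2 * PowerSeries.X) : PowerSeries ℚ) = 2 * (1 - PowerSeries.X)
          by ring, show (1 - (1 - 2 * PowerSeries.X) : PowerSeries ℚ) = 2 * PowerSeries.X by ring,
          mul_pow, mul_pow]
        ring
    _ = _ := by ring

theorem det_choose_even_matrix (d k : ℕ) (x : ℕ → ℕ) (hx : ∀ i < k, x i < 2 * k) :
    (Matrix.of fun i j : Fin k => ((x i).choose (2 * j) : ℚ)).det * 4 ^ (k.choose 2) =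
      (2 ^ (∑ i ∈ Finset.range k, x i) / 2 ^ k) * (powerSumMatrix d k x * reflMatrix k).det := by
  have h := congrArg Matrix.det (choose_even_matrix_mul d k x hx)
  rw [Matrix.det_mul, Matrix.det_mul, det_substMatrix,
    Matrix.det_mul_column (fun i : Fin k => (2 ^ x i / 2 : ℚ)) (powerSumMatrix d k x),
    Fin.prod_univ_eq_prod_range (fun i => (2 ^ x i / 2 : ℚ)) k, Finset.prod_div_distrib,
    Finset.prod_pow_eq_pow_sum, Finset.prod_const, Finset.card_range] at h
  have hr := reflMatrix_det_mul_self k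
  -- `reflMatrix` now enters twice, so the sign of its determinant is irrelevant.
  rw [Matrix.det_mul, ← mul_assoc, ← h]
  linear_combination (-(Matrix.of fun i j : Fin k => ((x i).choose (2 * j) : ℚ)).det *
    4 ^ (k.choose 2)) * hr

theorem det_eq_det_of_unit_rows {R : Type*} [CommRing R] (A : ℕ → ℕ → R) (l k : ℕ) (hlk : l ≤ k)
    (h : ∀ i, l ≤ i → ∀ j, A i j = if j = i then 1 else 0) :
    (Matrix.of fun i j : Fin k => A i j).det = (Matrix.of fun i j : Fin l => A i j).det := by
  induction k, hlk using Nat.le_induction with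
  | base => rfl
  | succ k hk ih =>
    rw [Matrix.det_succ_row _ (Fin.last k), Finset.sum_eq_single (Fin.last k)]
    · rw [← ih]
      simp [h k hk, ← two_mul, Matrix.submatrix, Fin.succAbove_last]
    · intro j _ hj
      have : (j : ℕ) ≠ k := fun e => hj (Fin.ext e)
      simp [h k hk, this]
    · simp

/-! ### Polynomiality of the entries in `k`. -/

/-- The polynomial `binom (X + c) r`. -/
noncomputable def choosePoly (c : ℚ) (r : ℕ) : ℚ[X] :=
  C ((r.factorial : ℚ)⁻¹) * (descPochhammer ℚ r).comp (X + C c)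

theorem choosePoly_eval (c x : ℚ) (r : ℕ) : (choosePoly c r).eval x = Ring.choose (x + c) r := by
  rw [choosePoly, Ring.choose_eq_smul, ← descPochhammer_map (Int.castRingHom ℚ) r, eval_mul,
    eval_C, eval_comp, eval_map, smul_eq_mul, ← eval₂_smulOneHom_eq_smeval]
  congr 2 <;> simp

theorem choosePoly_eval_eq {c x : ℚ} {n : ℕ} (h : x + c = n) (r : ℕ) :
    (choosePoly c r).eval x = n.choose r := by
  rw [choosePoly_eval, h, Ring.choose_natCast]

theorem choosePoly_eval_eq_neg {c x : ℚ} {n r : ℕ} (h : x + c = r - n - 1) :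
    (choosePoly c r).eval x = (-1) ^ r * n.choose r := by
  rw [choosePoly_eval, h, show (r - n - 1 : ℚ) = -(n + 1 - r) by ring, Ring.choose_neg,
    show (n + 1 - r + r - 1 : ℚ) = n by ring, Ring.choose_natCast, Units.smul_def,
    Int.coe_negOnePow_natCast]
  simp

theorem natDegree_choosePoly_le (c : ℚ) (r : ℕ) : (choosePoly c r).natDegree ≤ r := by
  refine (natDegree_C_mul_le _ _).trans ?_
  rw [natDegree_comp, natDegree_X_add_C, mul_one]
  exact (descPochhammer_natDegree ℚ r).le

/-- For `m = d + 1`, the polynomial in `k` giving the coefficient of `(1 - z) ^ j` in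
`(1 - z) ^ (-m) + z ^ (k - m) (1 - z) ^ (-k)` modulo `z ^ k`. -/
noncomputable def entryPoly (d j : ℕ) : ℚ[X] :=
  C ((-1) ^ j) * (C ((d + j).choose j : ℚ) * choosePoly d (d + 1 + j) +
    ∑ s ∈ Finset.range (d + 1), choosePoly (s - 1) s * choosePoly (s - (d + 1)) j)

-- Hockey stick, as `binom (d+n) d * binom n j = binom (d+j) j * binom (d+n) (d+j)`.
open Finset in
theorem sum_choose_mul_choose (d j k : ℕ) :
    ∑ n ∈ range k, (d + n).choose d * n.choose j =
      (d + j).choose j * (k + d).choose (d + 1 + j) := by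
  induction k with
  | zero => simp [Nat.choose_eq_zero_of_lt (show d < d + 1 + j by omega)]
  | succ k ih =>
    rw [sum_range_succ, ih, show k + 1 + d = (k + d) + 1 by ring,
      show d + 1 + j = (d + j) + 1 by ring, Nat.choose_succ_succ, mul_add, add_comm]
    congr 1
    rw [Nat.choose_symm_add, mul_comm ((d + j).choose j), add_comm k d]
    have h := Nat.choose_mul (n := d + k) (k := d + j) (s := d) (Nat.le_add_right d j)
    rw [Nat.add_sub_cancel_left, Nat.add_sub_cancel_left, Nat.choose_symm_add,
      Nat.choose_symm_add] at h
    rw [← h]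

-- With `k = K + 1`, the factor `z ^ (K - d)` leaves only the indices `n = K - d + s`, `s ≤ d`. The
-- number of terms is thus independent of `k`, which makes the sum polynomial.
open Finset in
theorem sum_coeff_eq_entryPoly_eval (K d j : ℕ) (hd : d ≤ K) :
    ∑ n ∈ range (K + 1), PowerSeries.coeff n (((1 - PowerSeries.X) ^ (K - d) +
      PowerSeries.X ^ (K - d)) * invPow K) * ((-1) ^ j * (n.choose j : ℚ)) =
      (entryPoly d j).eval ((K + 1 : ℕ) : ℚ) := by
  obtain ⟨e, rfl⟩ := Nat.exists_eq_add_of_le hd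
  rw [Nat.add_sub_cancel_left]
  have h1 : (1 - PowerSeries.X) ^ e * invPow (d + e) = invPow d := by
    calc (1 - PowerSeries.X) ^ e * invPow (d + e)
        = (1 - PowerSeries.X) ^ e * invPow (d + e) *
          (invPow d * (1 - PowerSeries.X) ^ (d + 1)) := by rw [invPow_mul, mul_one]
      _ = invPow d * (invPow (d + e) * (1 - PowerSeries.X) ^ (d + e + 1)) := by ring
      _ = invPow d := by rw [invPow_mul, mul_one]
  have h2 : ∑ n ∈ range (d + e + 1), PowerSeries.coeff n (invPow d) * (n.choose j : ℚ) =
      (d + j).choose j * (d + e + 1 + d).choose (d + 1 + j) := by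
    rw [← Nat.cast_mul, ← sum_choose_mul_choose]
    simp [invPow]
  have h3 : ∑ n ∈ range (d + e + 1),
      PowerSeries.coeff n (PowerSeries.X ^ e * invPow (d + e)) * (n.choose j : ℚ) =
      ∑ s ∈ range (d + 1), ((d + e + s).choose s : ℚ) * (e + s).choose j := by
    rw [show d + e + 1 = e + (d + 1) by ring, sum_range_add, sum_eq_zero, zero_add]
    · refine sum_congr rfl fun s _ => ?_
      rw [PowerSeries.coeff_X_pow_mul', if_pos (Nat.le_add_right _ _), Nat.add_sub_cancel_left,
        invPow, PowerSeries.coeff_mk, Nat.choose_symm_add]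
    · intro n hn
      rw [PowerSeries.coeff_X_pow_mul', if_neg (by simpa using hn), zero_mul]
  simp only [add_mul, h1, map_add]
  rw [entryPoly, eval_mul, eval_C, eval_add, eval_mul, eval_C, eval_finsetSum,
    choosePoly_eval_eq (n := d + e + 1 + d) (by push_cast; ring), ← h2]
  have h4 : ∑ s ∈ range (d + 1), eval (((d + e + 1 : ℕ) : ℚ))
      (choosePoly (s - 1) s * choosePoly (s - (d + 1)) j) =
      ∑ s ∈ range (d + 1), ((d + e + s).choose s : ℚ) * (e + s).choose j := by
    refine sum_congr rfl fun s _ => ?_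
    rw [eval_mul, choosePoly_eval_eq (n := d + e + s) (by push_cast; ring),
      choosePoly_eval_eq (n := e + s) (by push_cast; ring)]
  rw [h4, ← h3, ← sum_add_distrib, mul_sum]
  exact sum_congr rfl fun n _ => by ring

-- Modulo `z ^ (K + 1)` the series is just `(1 - z) ^ p`.
open Finset in
theorem sum_coeff_eq_ite (K p j : ℕ) (hp : p ≤ K) :
    ∑ n ∈ range (K + 1), PowerSeries.coeff n (((1 - PowerSeries.X) ^ (K + 1 + p) +
      PowerSeries.X ^ (K + 1 + p)) * invPow K) * ((-1) ^ j * (n.choose j : ℚ)) =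
      if j = p then 1 else 0 := by
  rw [← sum_choose_mul_choose_alternating (Nat.lt_succ_of_le hp)]
  refine sum_congr rfl fun n hn => ?_
  congr 1
  have h1 : ((1 - PowerSeries.X) ^ (K + 1 + p) + PowerSeries.X ^ (K + 1 + p)) * invPow K =
      ((1 + -PowerSeries.X) ^ p) + PowerSeries.X ^ (K + 1 + p) * invPow K := by
    have := invPow_mul K
    rw [← sub_eq_add_neg]
    linear_combination (1 - PowerSeries.X) ^ p * this
  have hn' : n < K + 1 := mem_range.1 hn
  rw [h1, map_add, PowerSeries.coeff_X_pow_mul', if_neg (by omega), add_zero,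
    one_add_pow_eq_sum_range _ (Nat.lt_succ_of_le hp), map_sum, sum_eq_single n]
  · rw [neg_pow, ← mul_assoc, ← map_natCast (PowerSeries.C (R := ℚ)),
      ← map_one (PowerSeries.C (R := ℚ)), ← map_neg, ← map_pow, ← map_mul, PowerSeries.coeff_C_mul]
    simp [mul_comm]
  · intro b _ hb
    rw [neg_pow, ← mul_assoc, ← map_natCast (PowerSeries.C (R := ℚ)),
      ← map_one (PowerSeries.C (R := ℚ)), ← map_neg, ← map_pow, ← map_mul, PowerSeries.coeff_C_mul,
      PowerSeries.coeff_X_pow, if_neg hb.symm, mul_zero]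
  · intro h; exact absurd hn h

/-! ### The polynomial `P_λ` and its uniqueness. -/

/-- The polynomial entries of a matrix of size `l(λ)` with determinant `P_λ`. -/
noncomputable def rowPoly (lam : ℕ →₀ ℕ) (i j : ℕ) : ℚ[X] :=
  if lam i ≤ i then (if j = i - lam i then 1 else 0) else entryPoly (lam i - i - 1) j

/-- The polynomial `P_λ`. -/
noncomputable def detPoly (lam : ℕ →₀ ℕ) : ℚ[X] :=
  (Matrix.of fun i j : Fin (partLength lam) => rowPoly lam i j).det

theorem detPoly_eval (lam : ℕ →₀ ℕ) (x : ℚ) :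
    (detPoly lam).eval x =
      (Matrix.of fun i j : Fin (partLength lam) => (rowPoly lam i j).eval x).det := by
  rw [detPoly, ← coe_evalRingHom, RingHom.map_det]
  rfl

theorem support_eq_range {lam : ℕ →₀ ℕ} (hlam : IsPartitionSeq lam) :
    lam.support = Finset.range (partLength lam) := by
  have hlow : IsLowerSet (lam.support : Set ℕ) := by
    intro a b hba ha
    have := hlam hba
    simp only [Finset.mem_coe, Finsupp.mem_support_iff] at ha ⊢
    simp only at this
    omega
  have hsub : lam.support ⊆ Finset.range (partLength lam) := by
    intro a ha
    have h : Finset.range (a + 1) ⊆ lam.support := by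
      intro b hb
      exact hlow (Nat.lt_succ_iff.1 (Finset.mem_range.1 hb)) ha
    have := Finset.card_le_card h
    rw [Finset.card_range] at this
    exact Finset.mem_range.2 this
  exact Finset.eq_of_subset_of_card_le hsub (by simp [partLength])

theorem apply_eq_zero_iff {lam : ℕ →₀ ℕ} (hlam : IsPartitionSeq lam) (i : ℕ) :
    lam i = 0 ↔ partLength lam ≤ i := by
  have : i ∈ lam.support ↔ i < partLength lam := by
    rw [support_eq_range hlam, Finset.mem_range]
  rw [Finsupp.mem_support_iff] at this
  omega

theorem binomDet_eq_det {lam : ℕ →₀ ℕ} (hlam : IsPartitionSeq lam) {k : ℕ} (hk : lam 0 ≤ k) :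
    (binomDet lam k : ℚ) =
      (Matrix.of fun i j : Fin k => ((k + i - lam i).choose (2 * j) : ℚ)).det := by
  rw [binomDet, ← Matrix.det_submatrix_equiv_self Fin.revPerm (binomMatrix lam k),
    ← eq_intCast (Int.castRingHom ℚ), RingHom.map_det]
  congr 1
  ext i j
  have h0 : lam i ≤ lam 0 := hlam (Nat.zero_le _)
  have hi := i.2
  have hj := j.2
  simp only [RingHom.mapMatrix_apply, Matrix.map_apply, Matrix.submatrix_apply, binomMatrix,
    Matrix.of_apply, Fin.revPerm_apply, Fin.val_rev]
  rw [show k - (k - (i + 1) + 1) = (i : ℕ) by omega,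
    show 2 * k - 2 * (k - (j + 1) + 1) = 2 * (j : ℕ) by omega,
    show 2 * (k : ℤ) - (((k - (i + 1) : ℕ) : ℤ) + 1) - (lam i : ℤ) = ((k + i - lam i : ℕ) : ℤ) by
      omega, Ring.choose_natCast]
  simp

theorem powerSum_mul_refl_eq {lam : ℕ →₀ ℕ} (hlam : IsPartitionSeq lam) {K : ℕ}
    (hk : lam 0 ≤ K + 1) :
    powerSumMatrix K (K + 1) (fun i => K + 1 + i - lam i) * reflMatrix (K + 1) =
      Matrix.of fun i j : Fin (K + 1) => (rowPoly lam i j).eval ((K + 1 : ℕ) : ℚ) := by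
  ext i j
  have h0 : lam i ≤ lam 0 := hlam (Nat.zero_le _)
  have hi := i.2
  rw [Matrix.mul_apply]
  simp only [powerSumMatrix, reflMatrix, Matrix.of_apply]
  rw [Fin.sum_univ_eq_sum_range (fun n => PowerSeries.coeff n
    (((1 - PowerSeries.X) ^ (K + 1 + i - lam i) + PowerSeries.X ^ (K + 1 + i - lam i)) * invPow K)
      * ((-1) ^ (j : ℕ) * (n.choose j : ℚ))) (K + 1), rowPoly]
  split_ifs with h1 h2
  · rw [show K + 1 + i - lam i = K + 1 + (i - lam i) by omega, sum_coeff_eq_ite _ _ _ (by omega),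
      if_pos h2, eval_one]
  · rw [show K + 1 + i - lam i = K + 1 + (i - lam i) by omega, sum_coeff_eq_ite _ _ _ (by omega),
      if_neg h2, eval_zero]
  · rw [show K + 1 + i - lam i = K - (lam i - i - 1) by omega,
      sum_coeff_eq_entryPoly_eval _ _ _ (by omega)]

theorem sum_shifted_add_weight {lam : ℕ →₀ ℕ} (hlam : IsPartitionSeq lam) {k : ℕ}
    (hk : lam 0 ≤ k) (hl : partLength lam ≤ k) :
    (∑ i ∈ Finset.range k, (k + i - lam i)) + partWeight lam = k * k + k.choose 2 := by
  have hw : partWeight lam = ∑ i ∈ Finset.range k, lam i := by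
    rw [partWeight]
    refine Finset.sum_subset ?_ fun i _ hi => by simpa using hi
    rw [support_eq_range hlam]
    exact Finset.range_subset_range.2 hl
  rw [hw, ← Finset.sum_add_distrib, Nat.choose_two_right, ← Finset.sum_range_id]
  have h (i : ℕ) : k + i - lam i + lam i = k + i := by
    have : lam i ≤ lam 0 := hlam (Nat.zero_le _)
    omega
  simp only [h]
  rw [Finset.sum_add_distrib, Finset.sum_const, Finset.card_range, smul_eq_mul]

theorem partLength_pos {lam : ℕ →₀ ℕ} (hne : lam ≠ 0) : 0 < partLength lam :=
  Finset.card_pos.2 (Finsupp.support_nonempty_iff.2 hne)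

theorem isDetPolynomial_detPoly {lam : ℕ →₀ ℕ} (hlam : IsPartitionSeq lam) (hne : lam ≠ 0) :
    IsDetPolynomial lam (detPoly lam) := by
  intro k hk
  have hl : partLength lam ≤ k := le_trans (le_max_left _ _) hk
  have h0 : lam 0 ≤ k := le_trans (le_max_right _ _) hk
  have hpos := partLength_pos hne
  obtain ⟨K, rfl⟩ : ∃ K, k = K + 1 := ⟨k - 1, by omega⟩
  have hdet := det_choose_even_matrix K (K + 1) (fun i => K + 1 + i - lam i) (fun i hi => by omega)
  rw [powerSum_mul_refl_eq hlam h0, ← binomDet_eq_det hlam h0,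
    det_eq_det_of_unit_rows (fun i j => (rowPoly lam i j).eval ((K + 1 : ℕ) : ℚ)) _ _ hl,
    ← detPoly_eval] at hdet
  · have hs := sum_shifted_add_weight hlam h0 hl
    have hc : (K + 1).choose 2 * 2 = (K + 1) * K := by
      rw [Nat.choose_two_right]
      exact Nat.div_mul_cancel (Nat.even_mul_pred_self (K + 1)).two_dvd
    generalize (∑ i ∈ Finset.range (K + 1), (K + 1 + i - lam i)) = S at hdet hs
    have h2 : (2 : ℚ) ≠ 0 := two_ne_zero
    -- With `k = K + 1`: `S - k = k(k-1) + binom k 2 - |λ|`, and `k(k-1) = 2 binom k 2` absorbs the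
    -- power of 4.
    have hexp : (2 : ℚ) ^ (((K + 1).choose 2 : ℤ) - (partWeight lam : ℤ)) * 4 ^ ((K + 1).choose 2) =
        2 ^ S / 2 ^ (K + 1) := by
      rw [show (4 : ℚ) = 2 ^ 2 by norm_num, ← pow_mul, ← zpow_natCast, ← zpow_natCast,
        ← zpow_natCast, ← zpow_add₀ h2, ← zpow_sub₀ h2]
      congr 1
      push_cast
      zify at hs hc
      linarith
    have h4 : (4 : ℚ) ^ ((K + 1).choose 2) ≠ 0 := by positivity
    apply mul_right_cancel₀ h4
    rw [hdet, ← hexp]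
    ring
  · intro i hi j
    have : lam i = 0 := (apply_eq_zero_iff hlam i).2 hi
    simp only [rowPoly, this, Nat.zero_le, if_true, Nat.sub_zero]
    split_ifs <;> simp

theorem isDetPolynomial_unique {lam : ℕ →₀ ℕ} {P Q : ℚ[X]} (hP : IsDetPolynomial lam P)
    (hQ : IsDetPolynomial lam Q) : P = Q := by
  apply eq_of_infinite_eval_eq
  have hinf : (Set.Ici (max (partLength lam) (lam 0))).Infinite := Set.Ici_infinite _
  refine (hinf.image (f := fun n : ℕ => (n : ℚ)) Nat.cast_injective.injOn).mono ?_
  rintro _ ⟨k, hk, rfl⟩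
  have := (hP k hk).symm.trans (hQ k hk)
  exact mul_left_cancel₀ (by positivity) this

/-! ### Roots of `P_λ` and divisibility. -/

/-- At `k = a` the truncation has degree below `a`, so it has no `(1 - z) ^ j` term. -/
theorem entryPoly_eval_natCast_eq_zero {d j a : ℕ} (hd : d < a) (hj : a ≤ j) :
    (entryPoly d j).eval (a : ℚ) = 0 := by
  rw [entryPoly, eval_mul, eval_add, eval_mul, eval_finsetSum, Finset.sum_eq_zero,
    choosePoly_eval_eq (n := a + d) (by push_cast; ring),
    Nat.choose_eq_zero_of_lt (show a + d < d + 1 + j by omega)]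
  · simp
  · intro s hs
    have hs' := Finset.mem_range.1 hs
    rw [eval_mul, choosePoly_eval_eq (c := s - (d + 1)) (n := a - (d + 1) + s)
      (by rw [Nat.cast_add, Nat.cast_sub (by omega)]; push_cast; ring),
      Nat.choose_eq_zero_of_lt (by omega)]
    simp

-- At `k = -a` the sum over `s` is an `a`-th finite difference of a polynomial in `s` of degree at
-- most `j < a`.
open Finset in
theorem entryPoly_eval_neg_eq_zero {d j a : ℕ} (hj : j < a) (ha : a ≤ d + 1) :
    (entryPoly d j).eval (-(a : ℚ)) = 0 := by
  have hfd : ∑ s ∈ range (a + 1), (-1) ^ s * (a.choose s : ℚ) *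
      (choosePoly (s - (d + 1)) j).eval (-(a : ℚ)) = 0 := by
    have h := congrFun (Polynomial.fwdDiff_iter_eq_zero_of_degree_lt
      ((natDegree_choosePoly_le 0 j).trans_lt hj)) (-(a : ℚ) - (d + 1))
    rw [fwdDiff_iter_eq_sum_shift] at h
    have h' := congrArg (fun x => (-1) ^ a * x) h
    simp only [Pi.zero_apply, mul_zero, mul_sum] at h'
    rw [← h']
    refine sum_congr rfl fun s hs => ?_
    have hs' : s ≤ a := Nat.lt_succ_iff.1 (mem_range.1 hs)
    have hsign : (-1 : ℚ) ^ a * (-1) ^ (a - s) = (-1) ^ s := by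
      obtain ⟨t, rfl⟩ := Nat.exists_eq_add_of_le hs'
      rw [Nat.add_sub_cancel_left, pow_add, mul_assoc, ← mul_pow]
      simp
    rw [choosePoly_eval, choosePoly_eval, zsmul_eq_mul]
    push_cast
    rw [← mul_assoc, ← mul_assoc, hsign]
    congr 2
    simp
    ring
  have hterm (s : ℕ) : (choosePoly (s - 1) s * choosePoly (s - (d + 1)) j).eval (-(a : ℚ)) =
      (-1) ^ s * (a.choose s : ℚ) * (choosePoly (s - (d + 1)) j).eval (-(a : ℚ)) := by
    rw [eval_mul, choosePoly_eval_eq_neg (n := a) (by ring)]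
  rw [entryPoly, eval_mul, eval_add, eval_mul, eval_finsetSum, eval_C, eval_C]
  simp only [hterm]
  rcases ha.lt_or_eq with h | rfl
  · rw [← sum_subset (range_subset_range.2 (Nat.succ_le_of_lt h)), hfd,
      choosePoly_eval_eq (n := d - a) (by rw [Nat.cast_sub (by omega)]; ring),
      Nat.choose_eq_zero_of_lt (show d - a < d + 1 + j by omega)]
    · simp
    · intro s _ hs
      rw [Nat.choose_eq_zero_of_lt (by simpa using hs)]
      simp
  -- For `a = d + 1` the sum stops one term short of the full difference; the first summand of
  -- `entryPoly` supplies the missing `s = a`.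
  · rw [sum_range_succ] at hfd
    rw [choosePoly_eval_eq_neg (c := d) (n := d + 1 + j) (by push_cast; ring), Nat.choose_self]
    rw [choosePoly_eval_eq_neg (c := ((d + 1 : ℕ) : ℚ) - (d + 1)) (n := d + j) (by push_cast; ring),
      Nat.choose_self] at hfd
    push_cast at hfd ⊢
    linear_combination (-1) ^ j * hfd

theorem detPoly_eval_natCast_eq_zero {lam : ℕ →₀ ℕ} (hlam : IsPartitionSeq lam) {a : ℕ}
    (ha0 : lam 0 ≤ a) (hal : a < partLength lam) : (detPoly lam).eval (a : ℚ) = 0 := by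
  rw [detPoly_eval]
  -- Since `lam i ≥ 1` in every row, no unit row has its 1 in the last column.
  refine Matrix.det_eq_zero_of_column_eq_zero ⟨partLength lam - 1, by omega⟩ fun i => ?_
  have h0 : lam i ≤ lam 0 := hlam (Nat.zero_le _)
  have hi := i.2
  have hne : lam i ≠ 0 := fun h => by
    have := (apply_eq_zero_iff hlam i).1 h
    omega
  rw [Matrix.of_apply, rowPoly]
  split_ifs with h1 h2
  · simp only at h2
    omega
  · exact eval_zero
  · exact entryPoly_eval_natCast_eq_zero (by omega) (by simp only; omega)

theorem detPoly_eval_neg_eq_zero {lam : ℕ →₀ ℕ} (hne : lam ≠ 0) {a : ℕ}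
    (hal : partLength lam ≤ a) (ha0 : a ≤ lam 0) : (detPoly lam).eval (-(a : ℚ)) = 0 := by
  have hpos := partLength_pos hne
  rw [detPoly_eval]
  -- The top row has `d + 1 = lam 0`, and its column indices satisfy `j < l(λ) ≤ a`.
  refine Matrix.det_eq_zero_of_row_eq_zero ⟨0, hpos⟩ fun j => ?_
  have hj := j.2
  rw [Matrix.of_apply, rowPoly, if_neg (by simp only; omega)]
  exact entryPoly_eval_neg_eq_zero (by omega) (by simp only; omega)

theorem prod_X_sub_C_dvd {s : Finset ℕ} {f : ℕ → ℚ} (hf : Function.Injective f) {P : ℚ[X]}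
    (h : ∀ a ∈ s, P.eval (f a) = 0) : (∏ a ∈ s, (X - C (f a))) ∣ P :=
  Finset.prod_dvd_of_coprime (fun _ _ _ _ hab => pairwise_coprime_X_sub_C hf hab)
    fun a ha => dvd_iff_isRoot.2 (h a ha)

theorem corollary2 (lam : ℕ →₀ ℕ) (hlam : IsPartitionSeq lam) (hne : lam ≠ 0) :
    (∃! P : ℚ[X], IsDetPolynomial lam P) ∧
      ∀ P : ℚ[X], IsDetPolynomial lam P →
        (lam 0 < partLength lam →
          (∏ a ∈ Finset.Ico (lam 0) (partLength lam), (X - C (a : ℚ))) ∣ P) ∧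
        (partLength lam ≤ lam 0 →
          (∏ a ∈ Finset.Icc (partLength lam) (lam 0), (X + C (a : ℚ))) ∣ P) := by
  have hdet := isDetPolynomial_detPoly hlam hne
  refine ⟨⟨detPoly lam, hdet, fun Q hQ => isDetPolynomial_unique hQ hdet⟩, fun P hP => ?_⟩
  obtain rfl := isDetPolynomial_unique hP hdet
  refine ⟨fun _ => ?_, fun _ => ?_⟩
  · refine prod_X_sub_C_dvd Nat.cast_injective fun a ha => ?_
    obtain ⟨h1, h2⟩ := Finset.mem_Ico.1 ha
    exact detPoly_eval_natCast_eq_zero hlam h1 h2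
  · have := prod_X_sub_C_dvd (s := Finset.Icc (partLength lam) (lam 0)) (f := fun a => -(a : ℚ))
      (neg_injective.comp Nat.cast_injective) (P := detPoly lam) fun a ha => by
        obtain ⟨h1, h2⟩ := Finset.mem_Icc.1 ha
        exact detPoly_eval_neg_eq_zero hne h1 h2
    simpa using this
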